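/- Let $I$ be a nonempty totally ordered set and let $\theta$ be the order type of the chain $\{0\}+I$ (a new least element $0$ placed below $I$). An $LM_\theta$-algebra is a bounded distributive lattice $\langle A,\vee,\wedge,0,1\rangle$ with unary operations $\phi_i,\overline{\phi}_i$ ($i\in I$) such that, for all $i,j\in I$ and $x,y\in A$: (L1) $\phi_i$ is an endomorphism of bounded lattices; (L2) $\phi_i x\vee\overline{\phi}_i x=1$ and $\phi_i x\wedge\overline{\phi}_i x=0$; (L3) $\phi_i\phi_j x=\phi_j x$; (L4) $i\le j$ implies $\phi_i x\le\phi_j x$; (L5) if $\phi_k x=\phi_k y$ for all $k\in I$, then $x=y$. Let $A$ be an $LM_\theta$-algebra. Let $Con_{LM_\theta}(A)$ be the lattice, ordered by inclusion, of all congruences of $A$, i.e. equivalence relations on $A$ compatible with $\vee,\wedge$ and all $\phi_i,\overline{\phi}_i$; it is a bounded distributive lattice. A congruence is called Boolean if it has a complement in $Con_{LM_\theta}(A)$, and $Con_{bLM_\theta}(A)$ denotes the Boolean algebra of all Boolean congruences. Let $C(A)$ be the Boolean algebra of all Boolean (i.e. complemented) elements of $A$. Then the Boolean algebras $Con_{bLM_\theta}(A)$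 and $C(A)$ are isomorphic, and therefore $|Con_{bLM_\theta}(A)|=|C(A)|$. -/

import Mathlib

/-- A `θ`-valued Łukasiewicz--Moisil algebra structure on the bounded distributive lattice `A`.
Here `θ` is the order type of the chain `{0} + I`, so the operations are indexed by the chain `I`.
`phi i` is an endomorphism of bounded lattices. -/
class LMAlgebra (I : Type*) (A : Type*) [LinearOrder I] [DistribLattice A] [BoundedOrder A] where
  phi : I → BoundedLatticeHom A A
  phibar : I → A → A
  phi_sup_phibar : ∀ (i : I) (x : A), phi i x ⊔ phibar i x = ⊤
  phi_inf_phibar : ∀ (i : I) (x : A), phi i x ⊓ phibar i x = ⊥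
  phi_phi : ∀ (i j : I) (x : A), phi i (phi j x) = phi j x
  phi_mono : ∀ (i j : I), i ≤ j → ∀ x : A, phi i x ≤ phi j x
  determination : ∀ x y : A, (∀ i : I, phi i x = phi i y) → x = y

/-- A congruence of an `LM_θ`-algebra: an equivalence relation compatible with all operations. -/
@[ext]
structure LMCon (I : Type*) (A : Type*) [LinearOrder I] [DistribLattice A] [BoundedOrder A]
    [LMAlgebra I A] where
  r : A → A → Prop
  equiv : Equivalence r
  sup : ∀ {w x y z : A}, r w x → r y z → r (w ⊔ y) (x ⊔ z)
  inf : ∀ {w x y z : A}, r w x → r y z → r (w ⊓ y) (x ⊓ z)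
  phi : ∀ (i : I) {x y : A}, r x y → r (LMAlgebra.phi i x) (LMAlgebra.phi i y)
  phibar : ∀ (i : I) {x y : A}, r x y → r (LMAlgebra.phibar i x) (LMAlgebra.phibar i y)

namespace LMCon

theorem eqvGen_map {A : Type*} {r : A → A → Prop} (f : A → A)
    (hf : ∀ x y, r x y → r (f x) (f y)) {x y : A} (h : Relation.EqvGen r x y) :
    Relation.EqvGen r (f x) (f y) := by
  induction h with
  | rel x y h => exact .rel _ _ (hf x y h)
  | refl x => exact .refl _
  | symm x y _ ih => exact .symm _ _ ih
  | trans x y z _ _ ih1 ih2 => exact .trans _ _ _ ih1 ih2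

/-- Congruences are ordered by inclusion, `c ⊓ d` is the intersection, and `c ⊔ d` is the
equivalence relation generated by the union (which is again a congruence). -/
instance instLattice (I : Type*) (A : Type*) [LinearOrder I] [DistribLattice A] [BoundedOrder A]
    [LMAlgebra I A] : Lattice (LMCon I A) where
  le c d := ∀ x y : A, c.r x y → d.r x y
  le_refl _ _ _ h := h
  le_trans _ _ _ h1 h2 x y h := h2 x y (h1 x y h)
  le_antisymm _ _ h1 h2 := LMCon.ext (funext fun x => funext fun y => propext ⟨h1 x y, h2 x y⟩)
  inf c d :=
    { r := fun x y => c.r x y ∧ d.r x y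
      equiv := ⟨fun x => ⟨c.equiv.refl x, d.equiv.refl x⟩,
        fun h => ⟨c.equiv.symm h.1, d.equiv.symm h.2⟩,
        fun h h' => ⟨c.equiv.trans h.1 h'.1, d.equiv.trans h.2 h'.2⟩⟩
      sup := fun h h' => ⟨c.sup h.1 h'.1, d.sup h.2 h'.2⟩
      inf := fun h h' => ⟨c.inf h.1 h'.1, d.inf h.2 h'.2⟩
      phi := fun i _ _ h => ⟨c.phi i h.1, d.phi i h.2⟩
      phibar := fun i _ _ h => ⟨c.phibar i h.1, d.phibar i h.2⟩ }
  sup c d :=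
    { r := Relation.EqvGen fun x y => c.r x y ∨ d.r x y
      equiv := Relation.EqvGen.is_equivalence _
      sup := fun {_ x y _} h h' => .trans _ _ _
        (eqvGen_map (· ⊔ y) (fun _ _ =>
          Or.imp (fun h => c.sup h (c.equiv.refl y)) (fun h => d.sup h (d.equiv.refl y))) h)
        (eqvGen_map (x ⊔ ·) (fun _ _ =>
          Or.imp (fun h => c.sup (c.equiv.refl x) h) (fun h => d.sup (d.equiv.refl x) h)) h')
      inf := fun {_ x y _} h h' => .trans _ _ _
        (eqvGen_map (· ⊓ y) (fun _ _ =>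
          Or.imp (fun h => c.inf h (c.equiv.refl y)) (fun h => d.inf h (d.equiv.refl y))) h)
        (eqvGen_map (x ⊓ ·) (fun _ _ =>
          Or.imp (fun h => c.inf (c.equiv.refl x) h) (fun h => d.inf (d.equiv.refl x) h)) h')
      phi := fun i _ _ h => eqvGen_map _ (fun _ _ => Or.imp (c.phi i) (d.phi i)) h
      phibar := fun i _ _ h => eqvGen_map _ (fun _ _ => Or.imp (c.phibar i) (d.phibar i)) h }
  inf_le_left _ _ _ _ h := h.1
  inf_le_right _ _ _ _ h := h.2
  le_inf _ _ _ h1 h2 x y h := ⟨h1 x y h, h2 x y h⟩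
  le_sup_left _ _ x y h := .rel x y (.inl h)
  le_sup_right _ _ x y h := .rel x y (.inr h)
  sup_le _ _ e h1 h2 x y h := by
    induction h with
    | rel x y h => exact h.elim (h1 x y) (h2 x y)
    | refl x => exact e.equiv.refl x
    | symm x y _ ih => exact e.equiv.symm ih
    | trans x y z _ _ ih1 ih2 => exact e.equiv.trans ih1 ih2

/-- The least congruence is equality and the greatest one relates all elements. -/
instance instBoundedOrder (I : Type*) (A : Type*) [LinearOrder I] [DistribLattice A]
    [BoundedOrder A] [LMAlgebra I A] : BoundedOrder (LMCon I A) where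
  bot :=
    { r := fun x y => x = y
      equiv := ⟨fun _ => rfl, Eq.symm, Eq.trans⟩
      sup := by rintro _ _ _ _ rfl rfl; rfl
      inf := by rintro _ _ _ _ rfl rfl; rfl
      phi := by rintro _ _ _ rfl; rfl
      phibar := by rintro _ _ _ rfl; rfl }
  top :=
    { r := fun _ _ => True
      equiv := ⟨fun _ => trivial, fun _ => trivial, fun _ _ => trivial⟩
      sup := fun _ _ => trivial
      inf := fun _ _ => trivial
      phi := fun _ _ _ _ => trivial
      phibar := fun _ _ _ _ => trivial }
  bot_le c x y h := by
    have h' : x = y := h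
    exact h' ▸ c.equiv.refl x
  le_top _ _ _ _ := trivial

/-- The congruence lattice is distributive, so that its complemented elements form a Boolean
algebra. -/
instance instDistribLattice (I : Type*) (A : Type*) [LinearOrder I] [DistribLattice A]
    [BoundedOrder A] [LMAlgebra I A] : DistribLattice (LMCon I A) :=
  DistribLattice.ofInfSupLe fun a b c => by
    rintro x y ⟨hxy, h⟩
    -- the median term `m t = (x ⊓ y) ⊔ ((x ⊔ y) ⊓ t)` moves the chain inside `a`
    have key : ∀ s t : A, Relation.EqvGen (fun x y => b.r x y ∨ c.r x y) s t →
        ((a ⊓ b) ⊔ (a ⊓ c)).r ((x ⊓ y) ⊔ ((x ⊔ y) ⊓ s)) ((x ⊓ y) ⊔ ((x ⊔ y) ⊓ t)) := by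
      have ha : ∀ t : A, a.r ((x ⊓ y) ⊔ ((x ⊔ y) ⊓ t)) x := by
        intro t
        have h1 := a.sup (a.inf (a.equiv.refl x) (a.equiv.symm hxy))
          (a.inf (a.sup (a.equiv.refl x) (a.equiv.symm hxy)) (a.equiv.refl t))
        simpa using h1
      intro s t h
      induction h with
      | rel s t h =>
        have hst : a.r ((x ⊓ y) ⊔ ((x ⊔ y) ⊓ s)) ((x ⊓ y) ⊔ ((x ⊔ y) ⊓ t)) :=
          a.equiv.trans (ha s) (a.equiv.symm (ha t))
        refine .rel _ _ (h.imp (fun h => ⟨hst, ?_⟩) (fun h => ⟨hst, ?_⟩))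
        · exact b.sup (b.equiv.refl _) (b.inf (b.equiv.refl _) h)
        · exact c.sup (c.equiv.refl _) (c.inf (c.equiv.refl _) h)
      | refl s => exact LMCon.equiv _ |>.refl _
      | symm s t _ ih => exact LMCon.equiv _ |>.symm ih
      | trans s t u _ _ ih1 ih2 => exact LMCon.equiv _ |>.trans ih1 ih2
    have h1 := key x y h
    have hx : (x ⊓ y) ⊔ ((x ⊔ y) ⊓ x) = x := by simp
    have hy : (x ⊓ y) ⊔ ((x ⊔ y) ⊓ y) = y := by simp
    rwa [hx, hy] at h1

end LMCon

/-- The complemented (Boolean) elements of a bounded distributive lattice form a Boolean algebra,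
with the operations inherited from the lattice. -/
noncomputable instance instBooleanAlgebraComplementeds (L : Type*) [DistribLattice L]
    [BoundedOrder L] : BooleanAlgebra (Complementeds L) :=
  DistribLattice.booleanAlgebraOfComplemented (Complementeds L)

/-- The Boolean algebra `C(A)` of Boolean (complemented) elements of `A`. -/
abbrev BooleanElements (A : Type*) [DistribLattice A] [BoundedOrder A] : Type _ :=
  Complementeds A

/-- The Boolean algebra of Boolean congruences of an `LM_θ`-algebra `A`: the complemented elements
of its lattice of congruences. -/
abbrev BooleanCongruences (I : Type*) (A : Type*) [LinearOrder I] [DistribLattice A]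
    [BoundedOrder A] [LMAlgebra I A] : Type _ :=
  Complementeds (LMCon I A)

namespace LMAlgebra

variable {I A : Type*} [LinearOrder I] [DistribLattice A] [BoundedOrder A] [LMAlgebra I A]

/-! A complemented `a` is fixed by every `phi i`, so `x ⊔ a = y ⊔ a` is a congruence; `a ↦
ofComplemented I a` is an order embedding that carries complements to complements. For surjectivity,
let `c`, `d` be complementary congruences. A chain of `c`- and `d`-steps joins `⊥` to `⊤`. Under
some `phi i` it runs through complemented elements, whose symmetric differences yield `a`, `b` in
the `c`- and `d`-classes of `⊥` with `a ⊔ b = ⊤`. Then `a` and `b` are complements and `a`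
determines `c`. An order isomorphism preserves the Boolean operations. -/

theorem isCompl_phi_phibar (i : I) (x : A) : IsCompl (phi i x) (phibar i x) :=
  IsCompl.of_eq (phi_inf_phibar i x) (phi_sup_phibar i x)

/-- Complemented elements are fixed by every `phi i`. -/
theorem phi_eq_self_of_isCompl (i : I) {a b : A} (h : IsCompl a b) : phi i a = a := by
  have hc : ∀ k : I, IsCompl (phi k a) (phi k b) := fun k =>
    IsCompl.of_eq (by rw [← map_inf, h.inf_eq_bot, map_bot])
      (by rw [← map_sup, h.sup_eq_top, map_top])
  -- Monotonicity in the index, applied to `b` and reversed by complementation, gives the opposite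
  -- inequality for `a`.
  have hle : ∀ k l : I, k ≤ l → phi k a = phi l a := fun k l hkl =>
    le_antisymm (phi_mono k l hkl a) ((hc k).symm.Antitone (hc l).symm (phi_mono k l hkl b))
  refine determination (I := I) _ _ fun k => ?_
  rw [phi_phi]
  rcases le_total i k with hik | hki
  · exact hle i k hik
  · exact (hle k i hki).symm

end LMAlgebra

/-- Complementation is compatible with the congruence `x ⊔ a = y ⊔ a`. -/
theorem IsCompl.sup_right_congr {A : Type*} [DistribLattice A] [BoundedOrder A]
    {a p p' q q' : A} (hp : IsCompl p p') (hq : IsCompl q q') (h : p ⊔ a = q ⊔ a) :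
    p' ⊔ a = q' ⊔ a := by
  -- Both sides are relative complements of `p ⊔ a = q ⊔ a` in the interval from `a` to `⊤`, hence
  -- equal by distributivity.
  refine eq_of_inf_eq_sup_eq (a := p ⊔ a) ?_ ?_
  · conv_rhs => rw [h]
    rw [← sup_inf_right, ← sup_inf_right, hp.symm.inf_eq_bot, hq.symm.inf_eq_bot]
  · conv_rhs => rw [h]
    rw [← sup_sup_distrib_right, ← sup_sup_distrib_right, hp.symm.sup_eq_top,
      hq.symm.sup_eq_top]

namespace LMCon

open LMAlgebra

variable {I A : Type*} [LinearOrder I] [DistribLattice A] [BoundedOrder A] [LMAlgebra I A]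

/-- The congruence `x ⊔ a = y ⊔ a` attached to a complemented element `a`. -/
def ofComplemented (I : Type*) {A : Type*} [LinearOrder I] [DistribLattice A] [BoundedOrder A]
    [LMAlgebra I A] (a : A) (ha : IsComplemented a) : LMCon I A where
  r x y := x ⊔ a = y ⊔ a
  equiv := ⟨fun _ => rfl, Eq.symm, Eq.trans⟩
  sup {w x y z} h h' := by
    rw [sup_sup_distrib_right, h, h', ← sup_sup_distrib_right]
  inf {w x y z} h h' := by
    rw [sup_inf_right, h, h', ← sup_inf_right]
  phi i x y h := by
    obtain ⟨b, hb⟩ := ha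
    rw [← phi_eq_self_of_isCompl i hb, ← map_sup, h, map_sup]
  phibar i x y h := by
    obtain ⟨b, hb⟩ := ha
    refine (isCompl_phi_phibar i x).sup_right_congr (isCompl_phi_phibar i y) ?_
    rw [← phi_eq_self_of_isCompl i hb, ← map_sup, h, map_sup]

theorem ofComplemented_le_iff {a b : A} (ha : IsComplemented a) (hb : IsComplemented b) :
    ofComplemented I a ha ≤ ofComplemented I b hb ↔ a ≤ b := by
  constructor
  · intro h
    have h1 : ⊥ ⊔ b = a ⊔ b := h ⊥ a (show ⊥ ⊔ a = a ⊔ a by simp)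
    rw [bot_sup_eq] at h1
    exact h1 ▸ le_sup_left
  · intro h x y hxy
    have hxy' : x ⊔ a = y ⊔ a := hxy
    change x ⊔ b = y ⊔ b
    rw [← sup_eq_right.2 h, ← sup_assoc, hxy', sup_assoc]

theorem isCompl_ofComplemented {a b : A} (h : IsCompl a b) :
    IsCompl (ofComplemented I a ⟨b, h⟩) (ofComplemented I b ⟨a, h.symm⟩) := by
  refine IsCompl.of_le ?_ ?_
  · rintro x y ⟨hx, hy⟩
    have hx' : x ⊔ a = y ⊔ a := hx
    have hy' : x ⊔ b = y ⊔ b := hy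
    change x = y
    rw [← sup_bot_eq x, ← sup_bot_eq y, ← h.inf_eq_bot, sup_inf_left, hx', hy', ← sup_inf_left]
  · have key : ∀ x : A, ((ofComplemented I a ⟨b, h⟩) ⊔ (ofComplemented I b ⟨a, h.symm⟩)).r x ⊤ :=
      fun x => .trans _ (x ⊔ a) _ (.rel _ _ (.inl (show x ⊔ a = x ⊔ a ⊔ a by simp)))
        (.rel _ _ (.inr (show x ⊔ a ⊔ b = ⊤ ⊔ b by
          rw [sup_assoc, h.sup_eq_top, sup_top_eq, top_sup_eq])))
    exact fun x y _ => LMCon.equiv _ |>.trans (key x) (LMCon.equiv _ |>.symm (key y))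

/-- If `x` and `y` are congruent then `phi i x` and `phi i y` agree up to an element congruent
to `⊥`, namely their symmetric difference. -/
theorem exists_bot_rel_phi_sup_eq (c : LMCon I A) (i : I) {x y : A} (h : c.r x y) :
    ∃ a, c.r ⊥ a ∧ LMAlgebra.phi i x ⊔ a = LMAlgebra.phi i y ⊔ a := by
  have hx := isCompl_phi_phibar i x
  have hy := isCompl_phi_phibar i y
  have h1 := c.inf (c.phi i h) (c.equiv.refl (LMAlgebra.phibar i y))
  have h2 := c.inf (c.equiv.refl (LMAlgebra.phibar i x)) (c.phi i h)
  rw [hy.inf_eq_bot] at h1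
  rw [hx.symm.inf_eq_bot] at h2
  refine ⟨(LMAlgebra.phi i x ⊓ LMAlgebra.phibar i y) ⊔ (LMAlgebra.phibar i x ⊓ LMAlgebra.phi i y),
    by simpa using c.sup (c.equiv.symm h1) h2, le_antisymm ?_ ?_⟩
  · refine sup_le ?_ le_sup_right
    calc LMAlgebra.phi i x
        = (LMAlgebra.phi i x ⊓ LMAlgebra.phi i y) ⊔
            (LMAlgebra.phi i x ⊓ LMAlgebra.phibar i y) := by
          rw [← inf_sup_left, hy.sup_eq_top, inf_top_eq]
      _ ≤ _ := sup_le_sup inf_le_right le_sup_left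
  · refine sup_le ?_ le_sup_right
    calc LMAlgebra.phi i y
        = (LMAlgebra.phi i x ⊓ LMAlgebra.phi i y) ⊔
            (LMAlgebra.phibar i x ⊓ LMAlgebra.phi i y) := by
          rw [← inf_sup_right, hx.sup_eq_top, top_inf_eq]
      _ ≤ _ := sup_le_sup inf_le_left le_sup_right

/-- The witnesses of the single steps accumulate by joins along the chain, since each class of `⊥`
is closed under joins. -/
theorem exists_bot_rel_phi_sup_eq_of_sup (c d : LMCon I A) (i : I) {x y : A}
    (h : (c ⊔ d).r x y) :
    ∃ a b, c.r ⊥ a ∧ d.r ⊥ b ∧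
      LMAlgebra.phi i x ⊔ (a ⊔ b) = LMAlgebra.phi i y ⊔ (a ⊔ b) := by
  induction h with
  | rel x y h =>
    rcases h with h | h
    · obtain ⟨a, ha, e⟩ := c.exists_bot_rel_phi_sup_eq i h
      exact ⟨a, ⊥, ha, d.equiv.refl _, by simpa using e⟩
    · obtain ⟨b, hb, e⟩ := d.exists_bot_rel_phi_sup_eq i h
      exact ⟨⊥, b, c.equiv.refl _, hb, by simpa using e⟩
  | refl x => exact ⟨⊥, ⊥, c.equiv.refl _, d.equiv.refl _, rfl⟩
  | symm x y _ ih =>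
    obtain ⟨a, b, ha, hb, e⟩ := ih
    exact ⟨a, b, ha, hb, e.symm⟩
  | trans x y z _ _ ih1 ih2 =>
    obtain ⟨a, b, ha, hb, e⟩ := ih1
    obtain ⟨a', b', ha', hb', e'⟩ := ih2
    refine ⟨a ⊔ a', b ⊔ b', by simpa using c.sup ha ha', by simpa using d.sup hb hb', ?_⟩
    rw [sup_sup_sup_comm a a', ← sup_assoc, e, sup_assoc, sup_left_comm, e', sup_left_comm]

/-- Every Boolean congruence is attached to a complemented element. -/
theorem exists_eq_ofComplemented [Nonempty I] {c : LMCon I A} (hc : IsComplemented c) :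
    ∃ (a : A) (ha : IsComplemented a), ofComplemented I a ha = c := by
  obtain ⟨d, hcd⟩ := hc
  have hbot : ∀ {x y : A}, c.r x y → d.r x y → x = y := fun {x y} h h' =>
    hcd.disjoint.le_bot x y ⟨h, h'⟩
  obtain ⟨i⟩ := ‹Nonempty I›
  have htop : (c ⊔ d).r (⊥ : A) ⊤ := hcd.codisjoint.top_le ⊥ ⊤ trivial
  obtain ⟨a, b, ha, hb, e⟩ := exists_bot_rel_phi_sup_eq_of_sup c d i htop
  rw [map_bot, map_top, bot_sup_eq, top_sup_eq] at e
  have hinf : a ⊓ b = ⊥ := by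
    refine (hbot ?_ ?_).symm
    · simpa using c.inf ha (c.equiv.refl b)
    · simpa using d.inf (d.equiv.refl a) hb
  have hab : IsCompl a b := IsCompl.of_eq hinf e
  refine ⟨a, ⟨b, hab⟩, le_antisymm ?_ ?_⟩
  · intro x y hxy
    have hxy' : x ⊔ a = y ⊔ a := hxy
    have key : ∀ z : A, c.r z (z ⊔ a) := fun z => by
      simpa using c.sup (c.equiv.refl z) ha
    exact c.equiv.trans (key x) (hxy' ▸ c.equiv.symm (key y))
  -- `x ⊔ a` and `y ⊔ a` are `c`-related, and also `d`-related because `d` identifies both with `⊤`;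
  -- as `c ⊓ d = ⊥`, they coincide.
  · intro x y hxy
    have key : ∀ z : A, d.r (z ⊔ a) ⊤ := fun z => by
      simpa [sup_assoc, e] using d.sup (d.equiv.refl (z ⊔ a)) hb
    exact hbot (c.sup hxy (c.equiv.refl a)) (d.equiv.trans (key x) (d.equiv.symm (key y)))

/-- The Boolean congruences are order isomorphic to the Boolean elements. -/
noncomputable def booleanElementsIso (I A : Type*) [LinearOrder I] [Nonempty I]
    [DistribLattice A] [BoundedOrder A] [LMAlgebra I A] :
    BooleanElements A ≃o BooleanCongruences I A :=
  RelIso.ofSurjective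
    (OrderEmbedding.ofMapLEIff
      (fun a : BooleanElements A => (⟨ofComplemented I a.1 a.2,
        let ⟨_, h⟩ := a.2
        ⟨_, isCompl_ofComplemented h⟩⟩ : BooleanCongruences I A))
      fun a b => ofComplemented_le_iff a.2 b.2)
    fun c => by
      obtain ⟨a, ha, h⟩ := exists_eq_ofComplemented c.2
      exact ⟨⟨a, ha⟩, Subtype.ext h⟩

end LMCon

theorem mainTheorem10 {I : Type*} {A : Type*} [LinearOrder I] [Nonempty I]
    [DistribLattice A] [BoundedOrder A] [LMAlgebra I A] :
    (∃ e : BooleanCongruences I A ≃ BooleanElements A,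
      (∀ φ ψ, e (φ ⊔ ψ) = e φ ⊔ e ψ) ∧
      (∀ φ ψ, e (φ ⊓ ψ) = e φ ⊓ e ψ) ∧
      (∀ φ, e φᶜ = (e φ)ᶜ) ∧
      e ⊥ = ⊥ ∧ e ⊤ = ⊤) ∧
    Cardinal.mk (BooleanCongruences I A) = Cardinal.mk (BooleanElements A) := by
  let e := (LMCon.booleanElementsIso I A).symm
  exact ⟨⟨e.toEquiv, e.map_sup, e.map_inf, map_compl' e, e.map_bot, e.map_top⟩, Cardinal.mk_congr e.toEquiv⟩
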